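/- Let $M\ge 1$. For every $N\in\mathbb N$ let a population of $N$ spins be divided into $M$ groups of sizes $N_1,\dots,N_M$ (depending on $N$) with $N_1+\dots+N_M=N$, such that for every $\lambda$, as $N\to\infty$, $N_\lambda\to\infty$ and $N_\lambda/N\to\alpha_\lambda$; for those $\lambda$ with $\alpha_\lambda=0$ assume moreover that $(\log N)/N_\lambda\to 0$. Let $J=(J_{\lambda\mu})$ be a real $M\times M$ matrix. The canonical ensemble of size $N$ is the probability measure on spin configurations $x=(x_{\lambda i})$, $x_{\lambda i}\in\{-1,1\}$, $1\le\lambda\le M$, $1\le i\le N_\lambda$, given by $$\mathbb P_N(x)=Z_N^{-1}\exp\Big(\frac1{2N}\sum_{\lambda,\mu=1}^M J_{\lambda\mu}\sum_{i=1}^{N_\lambda}\sum_{j=1}^{N_\mu}x_{\lambda i}x_{\mu j}\Big),$$ where $Z_N$ is the normalising constant. Assume one of the following. - (High temperature regime) Either all entries of $J$ equal a constant $\beta$ with $0\le\beta<1$, or $J$ is symmetric positive definite and $H:=J^{-1}-\operatorname{diag}(\alpha_1,\dots,\alpha_M)$ is positive definite. - (Critical regime) Either all entries of $J$ equal $1$,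 or $J$ is symmetric positive definite and $H$ is positive semi-definite but not positive definite. Let $(\Omega,\mathcal A,\mathbb P)$ be any probability space carrying, for every $N$, random variables $X^{(N)}_{\lambda i}$ ($1\le\lambda\le M$, $1\le i\le N_\lambda$) whose joint law is $\mathbb P_N$ (the joint law for different $N$ is arbitrary), and let $S_\lambda=S^{(N)}_\lambda=\sum_{i=1}^{N_\lambda}X^{(N)}_{\lambda i}$. Then $$\lim_{N\to\infty}\Big(\frac{S_1}{N_1},\dots,\frac{S_M}{N_M}\Big)=(0,\dots,0)\qquad\mathbb P\text{-almost surely}.$$ -/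

import Mathlib

open Filter Topology MeasureTheory

namespace CurieWeiss

/-- Spin configurations of `M` groups, group `l` consisting of `n l` spins with values in
`ℤˣ = {1, -1}`. -/
abbrev SpinConfig {M : ℕ} (n : Fin M → ℕ) : Type :=
  (l : Fin M) → Fin (n l) → ℤˣ

/-- The value `±1` of the `i`-th spin of group `l`, as a real number. -/
def spin {M : ℕ} {n : Fin M → ℕ} (x : SpinConfig n) (l : Fin M) (i : Fin (n l)) : ℝ :=
  ((x l i : ℤ) : ℝ)

/-- The Hamiltonian with coupling matrix `J`; the population size is `N = ∑ l, n l`. -/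
noncomputable def hamiltonian {M : ℕ} (J : Matrix (Fin M) (Fin M) ℝ) (n : Fin M → ℕ)
    (x : SpinConfig n) : ℝ :=
  -(1 / (2 * ((∑ l, n l : ℕ) : ℝ))) *
    ∑ l, ∑ m, J l m * ∑ i : Fin (n l), ∑ j : Fin (n m), spin x l i * spin x m j

/-- The normalisation constant `Z`. -/
noncomputable def partitionFunction {M : ℕ} (J : Matrix (Fin M) (Fin M) ℝ) (n : Fin M → ℕ) : ℝ :=
  ∑ x : SpinConfig n, Real.exp (-hamiltonian J n x)

/-- The probability of the configuration `x` under the canonical ensemble. -/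
noncomputable def canonicalProb {M : ℕ} (J : Matrix (Fin M) (Fin M) ℝ) (n : Fin M → ℕ)
    (x : SpinConfig n) : ℝ :=
  (partitionFunction J n)⁻¹ * Real.exp (-hamiltonian J n x)

theorem partitionFunction_pos {M : ℕ} (J : Matrix (Fin M) (Fin M) ℝ) (n : Fin M → ℕ) :
    0 < partitionFunction J n :=
  Finset.sum_pos (fun _ _ => Real.exp_pos _) Finset.univ_nonempty

theorem canonicalProb_pos {M : ℕ} (J : Matrix (Fin M) (Fin M) ℝ) (n : Fin M → ℕ)
    (x : SpinConfig n) : 0 < canonicalProb J n x :=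
  mul_pos (inv_pos.2 (partitionFunction_pos J n)) (Real.exp_pos _)

theorem sum_canonicalProb {M : ℕ} (J : Matrix (Fin M) (Fin M) ℝ) (n : Fin M → ℕ) :
    ∑ x : SpinConfig n, canonicalProb J n x = 1 := by
  unfold canonicalProb
  rw [← Finset.mul_sum]
  exact inv_mul_cancel₀ (partitionFunction_pos J n).ne'

/-- The real random variables `X l i` on the probability space `(Ω, P)` are jointly distributed
as the spins of the canonical ensemble with coupling matrix `J` and group sizes `n`. -/
structure IsCanonicalEnsemble {M : ℕ} (J : Matrix (Fin M) (Fin M) ℝ) (n : Fin M → ℕ)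
    {Ω : Type*} [MeasurableSpace Ω] (P : Measure Ω)
    (X : (l : Fin M) → Fin (n l) → Ω → ℝ) : Prop where
  measurable : ∀ l i, Measurable (X l i)
  law : ∀ x : SpinConfig n,
    P {ω | ∀ l i, X l i ω = spin x l i} = ENNReal.ofReal (canonicalProb J n x)

/-- The `M × M` matrix all of whose entries are `β`. -/
def homogeneousCoupling (M : ℕ) (β : ℝ) : Matrix (Fin M) (Fin M) ℝ :=
  Matrix.of fun _ _ => β

/-- The matrix `H = J⁻¹ - diag(α)`. -/
noncomputable def hessian {M : ℕ} (α : Fin M → ℝ) (J : Matrix (Fin M) (Fin M) ℝ) :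
    Matrix (Fin M) (Fin M) ℝ :=
  J⁻¹ - Matrix.diagonal α

/-- The parameter space of the heterogeneous model: asymptotic relative group sizes and a
(symmetric) positive definite coupling matrix. -/
def heterogeneousParameters (M : ℕ) : Set ((Fin M → ℝ) × Matrix (Fin M) (Fin M) ℝ) :=
  {φ | (∀ l, 0 ≤ φ.1 l) ∧ ∑ l, φ.1 l = 1 ∧ φ.2.PosDef}

/-- The heterogeneous high temperature regime. -/
def heterogeneousHighTemperature (M : ℕ) : Set ((Fin M → ℝ) × Matrix (Fin M) (Fin M) ℝ) :=
  {φ | φ ∈ heterogeneousParameters M ∧ (hessian φ.1 φ.2).PosDef}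

/-- The heterogeneous critical regime. -/
def heterogeneousCritical (M : ℕ) : Set ((Fin M → ℝ) × Matrix (Fin M) (Fin M) ℝ) :=
  {φ | φ ∈ heterogeneousParameters M ∧
    (hessian φ.1 φ.2).PosSemidef ∧ ¬ (hessian φ.1 φ.2).PosDef}

/-- The high temperature regime, for homogeneous (`0 ≤ β < 1`) or heterogeneous coupling. -/
def IsHighTemperature {M : ℕ} (α : Fin M → ℝ) (J : Matrix (Fin M) (Fin M) ℝ) : Prop :=
  (∃ β : ℝ, 0 ≤ β ∧ β < 1 ∧ J = homogeneousCoupling M β) ∨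
    (α, J) ∈ heterogeneousHighTemperature M

/-- The critical regime, for homogeneous (`β = 1`) or heterogeneous coupling. -/
def IsCritical {M : ℕ} (α : Fin M → ℝ) (J : Matrix (Fin M) (Fin M) ℝ) : Prop :=
  J = homogeneousCoupling M 1 ∨ (α, J) ∈ heterogeneousCritical M

/-- The vector of normalised magnetisations `(S_1 / N_1, …, S_M / N_M)`. -/
noncomputable def normalisedMagnetisation {M : ℕ} {n : Fin M → ℕ} {Ω : Type*}
    (X : (l : Fin M) → Fin (n l) → Ω → ℝ) (ω : Ω) : Fin M → ℝ :=
  fun l => (∑ i, X l i ω) / (n l : ℝ)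

end CurieWeiss

namespace CurieWeiss

/-! Weights depend only on the vector `s` of group sums, of which there are polynomially many, and
`Z ≥ 2 ^ N` because the coupling form is nonnegative. So for a macroscopic group it suffices to
bound the contribution of each single `s` with `|s k| ≥ ε * n k`. Put `t l = s l / n l`. A Chernoff
bound with tilt `t` gives entropy at most `2 ^ N * exp (-∑ n l * t l ^ 2 / 2)`, while
`IsSubcritical` bounds the energy by `∑ n l * t l ^ 2 / 2 + o(N)`. The quadratic terms cancel, so in
the critical case the decay must come from the strict inequality `cosh t < exp (t ^ 2 / 2)`, which
gains `exp (-c * n k)` (`sum_canonicalProb_le_of_subcritical`). This beats `o(N)` when `α k > 0`.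

When `α l = 0` the `o(N)` error may exceed `c * n l`. There the group is decoupled instead: once
every other group sum is at most `δ * N`, the interactions of group `l` cost at most `exp (n l * ε ^
2 / 4)`, less than Hoeffding gains for independent spins (`sum_canonicalProb_le_of_small`). The
condition on `log N / n l` makes the result summable.

The first Borel–Cantelli lemma concludes; it needs no independence, so the coupling between
different `N` is irrelevant. -/

/-! ### The quadratic form of the coupling matrix -/

/-- The quadratic form `s ↦ ∑ l, m, J l m * s l * s m`. -/
def quadForm {M : ℕ} (J : Matrix (Fin M) (Fin M) ℝ) (s : Fin M → ℝ) : ℝ :=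
  ∑ l, ∑ m, J l m * (s l * s m)

theorem quadForm_eq_dotProduct {M : ℕ} (J : Matrix (Fin M) (Fin M) ℝ) (s : Fin M → ℝ) :
    quadForm J s = dotProduct s (J.mulVec s) := by
  simp only [quadForm, dotProduct, Matrix.mulVec, Finset.mul_sum]
  exact Finset.sum_congr rfl fun l _ => Finset.sum_congr rfl fun m _ => by ring

theorem quadForm_smul {M : ℕ} (J : Matrix (Fin M) (Fin M) ℝ) (c : ℝ) (s : Fin M → ℝ) :
    quadForm J (c • s) = c ^ 2 * quadForm J s := by
  simp only [quadForm, Finset.mul_sum, Pi.smul_apply, smul_eq_mul]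
  exact Finset.sum_congr rfl fun l _ => Finset.sum_congr rfl fun m _ => by ring

theorem quadForm_update {M : ℕ} {J : Matrix (Fin M) (Fin M) ℝ} (hJ : J.transpose = J)
    (s : Fin M → ℝ) (l : Fin M) (c : ℝ) :
    quadForm J (Function.update s l c) = quadForm J (Function.update s l 0) +
      2 * c * (∑ m, J l m * Function.update s l 0 m) + c ^ 2 * J l l := by
  have h : Function.update s l c = Function.update s l 0 + c • Pi.single l (1 : ℝ) := by
    ext m
    by_cases hm : m = l
    · subst hm; simp
    · simp [hm]
  rw [h]
  set r := Function.update s l 0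
  rw [quadForm_eq_dotProduct, quadForm_eq_dotProduct]
  have h1 : dotProduct r (J.mulVec (Pi.single l 1)) = dotProduct (Pi.single l 1) (J.mulVec r) := by
    rw [Matrix.dotProduct_mulVec, ← Matrix.mulVec_transpose, hJ, dotProduct_comm]
  have h2 : dotProduct (Pi.single l (1 : ℝ)) (J.mulVec r) = ∑ m, J l m * r m := by
    rw [single_one_dotProduct]; rfl
  have h3 : dotProduct (Pi.single l (1 : ℝ)) (J.mulVec (Pi.single l 1)) = J l l := by
    simp
  rw [Matrix.mulVec_add, Matrix.mulVec_smul, add_dotProduct, dotProduct_add, dotProduct_add,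
    smul_dotProduct, smul_dotProduct, dotProduct_smul, dotProduct_smul, h1, h2, h3]
  simp only [smul_eq_mul]
  ring

/-- What the high temperature and the critical regimes have in common. -/
structure IsSubcritical {M : ℕ} (α : Fin M → ℝ) (J : Matrix (Fin M) (Fin M) ℝ) : Prop where
  transpose_eq : J.transpose = J
  quadForm_nonneg : ∀ s, 0 ≤ quadForm J s
  quadForm_le : ∀ m : Fin M → ℝ, quadForm J (fun l => α l * m l) ≤ ∑ l, α l * m l ^ 2

/-- The form is `β * (∑ s l) ^ 2`, so Cauchy–Schwarz with the probability weights `α` and `β ≤ 1`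
suffice. -/
theorem isSubcritical_homogeneousCoupling {M : ℕ} {α : Fin M → ℝ} (hα : ∀ l, 0 ≤ α l)
    (hα1 : ∑ l, α l = 1) {β : ℝ} (h0 : 0 ≤ β) (h1 : β ≤ 1) :
    IsSubcritical α (homogeneousCoupling M β) := by
  have hq : ∀ s : Fin M → ℝ, quadForm (homogeneousCoupling M β) s = β * (∑ l, s l) ^ 2 := by
    intro s
    rw [sq, Finset.sum_mul_sum]
    simp only [quadForm, homogeneousCoupling, Matrix.of_apply, Finset.mul_sum]
  refine ⟨by ext; simp [homogeneousCoupling], fun s => ?_, fun m => ?_⟩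
  · rw [hq]; positivity
  · rw [hq]
    have h := Finset.sum_sq_le_sum_mul_sum_of_sq_le_mul Finset.univ (r := fun l => α l * m l)
      (f := α) (g := fun l => α l * m l ^ 2) (fun l _ => hα l)
      (fun l _ => mul_nonneg (hα l) (sq_nonneg _)) (fun l _ => le_of_eq (by ring))
    rw [hα1, one_mul] at h
    nlinarith [sq_nonneg (∑ l, α l * m l)]

/-- Let `y = α * m`, `u = J y`, `Q = quadForm J y`. Testing the Hessian at `u` gives `∑ α u² ≤ Q`.
Also `Q = ∑ α m u ≤ ∑ α m² / 2 + ∑ α u² / 2`, so half of `Q` can be absorbed on the left. -/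
theorem isSubcritical_of_posSemidef_hessian {M : ℕ} {α : Fin M → ℝ}
    {J : Matrix (Fin M) (Fin M) ℝ} (hα : ∀ l, 0 ≤ α l) (hJ : J.PosDef)
    (hH : (hessian α J).PosSemidef) : IsSubcritical α J := by
  refine ⟨(Matrix.conjTranspose_eq_transpose_of_trivial J).symm.trans hJ.isHermitian, fun s => ?_, fun m => ?_⟩
  · rw [quadForm_eq_dotProduct]
    simpa using hJ.posSemidef.dotProduct_mulVec_nonneg s
  · set y : Fin M → ℝ := fun l => α l * m l
    set u := J.mulVec y with hu
    have h1 := hH.dotProduct_mulVec_nonneg u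
    have hdet : IsUnit J.det := hJ.det_pos.ne'.isUnit
    have h2 : J⁻¹.mulVec u = y := by
      rw [hu, Matrix.mulVec_mulVec, Matrix.nonsing_inv_mul _ hdet, Matrix.one_mulVec]
    rw [hessian, Matrix.sub_mulVec, h2, dotProduct_sub] at h1
    have h3 : dotProduct (star u) y = quadForm J y := by
      rw [quadForm_eq_dotProduct, dotProduct_comm]; simp [hu]
    have h4 : dotProduct (star u) ((Matrix.diagonal α).mulVec u) = ∑ l, α l * u l ^ 2 := by
      simp only [dotProduct, Matrix.mulVec_diagonal]
      exact Finset.sum_congr rfl fun l _ => by simp; ring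
    have h5 : quadForm J y ≤ ∑ l, (α l * m l ^ 2 / 2 + α l * u l ^ 2 / 2) := by
      rw [quadForm_eq_dotProduct]
      refine Finset.sum_le_sum fun l _ => ?_
      nlinarith [mul_nonneg (hα l) (sq_nonneg (m l - u l))]
    rw [Finset.sum_add_distrib, ← Finset.sum_div, ← Finset.sum_div] at h5
    rw [h3, h4] at h1
    linarith

theorem isSubcritical_of_regime {M : ℕ} {α : Fin M → ℝ} {J : Matrix (Fin M) (Fin M) ℝ}
    (hα : ∀ l, 0 ≤ α l) (hα1 : ∑ l, α l = 1) (h : IsHighTemperature α J ∨ IsCritical α J) :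
    IsSubcritical α J := by
  rcases h with (⟨β, h0, h1, rfl⟩ | h) | (rfl | h)
  · exact isSubcritical_homogeneousCoupling hα hα1 h0 h1.le
  · exact isSubcritical_of_posSemidef_hessian hα h.1.2.2 h.2.posSemidef
  · exact isSubcritical_homogeneousCoupling hα hα1 zero_le_one le_rfl
  · exact isSubcritical_of_posSemidef_hessian hα h.1.2.2 h.2.1

theorem IsSubcritical.diag_nonneg {M : ℕ} {α : Fin M → ℝ} {J : Matrix (Fin M) (Fin M) ℝ}
    (h : IsSubcritical α J) (l : Fin M) : 0 ≤ J l l := by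
  have := h.quadForm_nonneg (Pi.single l 1)
  rw [quadForm_eq_dotProduct] at this
  simpa using this

/-- On the unit cube `m ↦ quadForm J (a * m)` is Lipschitz in `a ∈ [0, 1] ^ M`. -/
theorem quadForm_mul_le {M : ℕ} (J : Matrix (Fin M) (Fin M) ℝ) {a α m : Fin M → ℝ}
    (ha : ∀ l, |a l| ≤ 1) (hα : ∀ l, |α l| ≤ 1) (hm : ∀ l, |m l| ≤ 1) :
    quadForm J (fun l => a l * m l) ≤ quadForm J (fun l => α l * m l) +
      2 * (∑ l, ∑ k, |J l k|) * ∑ l, |a l - α l| := by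
  have key : ∀ l k, J l k * (a l * m l * (a k * m k)) ≤
      J l k * (α l * m l * (α k * m k)) + |J l k| * (2 * ∑ l, |a l - α l|) := by
    intro l k
    have h1 : |a l - α l| ≤ ∑ l, |a l - α l| :=
      Finset.single_le_sum (f := fun l => |a l - α l|) (fun _ _ => abs_nonneg _)
        (Finset.mem_univ l)
    have h2 : |a k - α k| ≤ ∑ l, |a l - α l| :=
      Finset.single_le_sum (f := fun l => |a l - α l|) (fun _ _ => abs_nonneg _)
        (Finset.mem_univ k)
    have h3 : |(a l * a k - α l * α k) * (m l * m k)| ≤ 2 * ∑ l, |a l - α l| := by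
      have e : a l * a k - α l * α k = (a l - α l) * a k + α l * (a k - α k) := by ring
      have h4 : |a l * a k - α l * α k| ≤ 2 * ∑ l, |a l - α l| := by
        rw [e]
        refine (abs_add_le _ _).trans ?_
        rw [abs_mul, abs_mul]
        nlinarith [abs_nonneg (a l - α l), abs_nonneg (a k - α k), ha k, hα l,
          abs_nonneg (a k), abs_nonneg (α l)]
      have h5 : |m l * m k| ≤ 1 := by
        rw [abs_mul]; exact mul_le_one₀ (hm l) (abs_nonneg _) (hm k)
      rw [abs_mul]
      nlinarith [abs_nonneg (a l * a k - α l * α k), abs_nonneg (m l * m k)]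
    have h6 := le_abs_self (J l k * ((a l * a k - α l * α k) * (m l * m k)))
    rw [abs_mul] at h6
    have h7 := mul_le_mul_of_nonneg_left h3 (abs_nonneg (J l k))
    linarith
  calc quadForm J (fun l => a l * m l)
      ≤ ∑ l, ∑ k, (J l k * (α l * m l * (α k * m k)) + |J l k| * (2 * ∑ l, |a l - α l|)) :=
        Finset.sum_le_sum fun l _ => Finset.sum_le_sum fun k _ => key l k
    _ = _ := by
        simp only [Finset.sum_add_distrib, ← Finset.sum_mul, quadForm]
        ring

/-! ### The deficit in `cosh t ≤ exp (t ^ 2 / 2)` -/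

/-- Termwise comparison of power series via `2 ^ i * i! ≤ (2 * i)!`; the terms first differ at `i =
2`, as `t ^ 4 / 24 < t ^ 4 / 8`. -/
theorem cosh_lt_exp_half_sq {t : ℝ} (ht : t ≠ 0) : Real.cosh t < Real.exp (t ^ 2 / 2) := by
  rw [Real.cosh_eq_tsum, Real.exp_eq_exp_ℝ, NormedSpace.exp_eq_tsum ℝ]
  refine Summable.tsum_lt_tsum (i := 2) (fun i => ?_) ?_ t.hasSum_cosh.summable
    (NormedSpace.expSeries_summable' (t ^ 2 / 2))
  · simp only [div_pow, pow_mul, smul_eq_mul, inv_mul_eq_div, div_div]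
    gcongr
    norm_cast
    exact Nat.two_pow_mul_factorial_le_factorial_two_mul _
  · have : 0 < t ^ 4 := by positivity
    norm_num [Nat.factorial]
    linarith

/-- The constant is the minimum over the compact `[ε, 1]` of the continuous positive deficit `t ^ 2
/ 2 - log (cosh t)`; for `ε > 1` the claim is vacuous. -/
theorem exists_cosh_le {ε : ℝ} (hε : 0 < ε) :
    ∃ c > 0, ∀ t : ℝ, ε ≤ |t| → |t| ≤ 1 → Real.cosh t ≤ Real.exp (t ^ 2 / 2 - c) := by
  by_cases h1 : 1 < ε
  · exact ⟨1, one_pos, fun t h h' => by linarith⟩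
  have hK : IsCompact (Set.Icc ε 1) := isCompact_Icc
  have hcont : ContinuousOn (fun t : ℝ => t ^ 2 / 2 - Real.log (Real.cosh t)) (Set.Icc ε 1) := by
    refine ContinuousOn.sub (by fun_prop) (ContinuousOn.log (by fun_prop) fun t _ =>
      (Real.cosh_pos t).ne')
  obtain ⟨t₀, ht₀, hmin⟩ := hK.exists_isMinOn ⟨ε, le_rfl, not_lt.1 h1⟩ hcont
  refine ⟨t₀ ^ 2 / 2 - Real.log (Real.cosh t₀), ?_, fun t h h' => ?_⟩
  · rw [gt_iff_lt, sub_pos, Real.log_lt_iff_lt_exp (Real.cosh_pos _)]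
    exact cosh_lt_exp_half_sq (hε.trans_le ht₀.1).ne'
  · have := hmin (show |t| ∈ Set.Icc ε 1 from ⟨h, h'⟩)
    simp only [Set.mem_ofPred_eq, sq_abs, Real.cosh_abs] at this
    rw [← Real.log_le_iff_le_exp (Real.cosh_pos _)]
    linarith

/-! ### Sums over spin configurations -/

/-- The magnetisation of group `l`. -/
def groupSum {M : ℕ} {n : Fin M → ℕ} (x : SpinConfig n) (l : Fin M) : ℝ :=
  ∑ i, spin x l i

/-- The unnormalised weight of a configuration. -/
noncomputable def weight {M : ℕ} (J : Matrix (Fin M) (Fin M) ℝ) (n : Fin M → ℕ)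
    (x : SpinConfig n) : ℝ :=
  Real.exp (quadForm J (groupSum x) / (2 * ((∑ l, n l : ℕ) : ℝ)))

theorem weight_pos {M : ℕ} (J : Matrix (Fin M) (Fin M) ℝ) (n : Fin M → ℕ) (x : SpinConfig n) :
    0 < weight J n x := Real.exp_pos _

theorem exp_neg_hamiltonian {M : ℕ} (J : Matrix (Fin M) (Fin M) ℝ) (n : Fin M → ℕ)
    (x : SpinConfig n) : Real.exp (-hamiltonian J n x) = weight J n x := by
  unfold weight hamiltonian quadForm groupSum
  simp only [Finset.sum_mul_sum]
  congr 1
  ring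

theorem partitionFunction_eq {M : ℕ} (J : Matrix (Fin M) (Fin M) ℝ) (n : Fin M → ℕ) :
    partitionFunction J n = ∑ x, weight J n x := by
  simp only [partitionFunction, exp_neg_hamiltonian]

theorem canonicalProb_eq {M : ℕ} (J : Matrix (Fin M) (Fin M) ℝ) (n : Fin M → ℕ)
    (x : SpinConfig n) : canonicalProb J n x = weight J n x / partitionFunction J n := by
  rw [canonicalProb, exp_neg_hamiltonian, inv_mul_eq_div]

theorem abs_groupSum_le {M : ℕ} {n : Fin M → ℕ} (x : SpinConfig n) (l : Fin M) :
    |groupSum x l| ≤ n l := by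
  refine (Finset.abs_sum_le_sum_abs _ _).trans ?_
  have : ∀ i, |spin x l i| = 1 := fun i => by
    rcases Int.units_eq_one_or (x l i) with h | h <;> simp [spin, h]
  simp [this]

theorem sum_units_exp (t : ℝ) :
    ∑ u : ℤˣ, Real.exp (t * ((u : ℤ) : ℝ)) = 2 * Real.cosh t := by
  rw [Real.cosh_eq]
  have : (Finset.univ : Finset ℤˣ) = {1, -1} := by decide
  rw [this, Finset.sum_pair (by decide)]
  simp
  ring

theorem sum_exp_group (k : ℕ) (t : ℝ) :
    ∑ y : Fin k → ℤˣ, Real.exp (t * ∑ i, ((y i : ℤ) : ℝ)) = (2 * Real.cosh t) ^ k := by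
  simp only [Finset.mul_sum, Real.exp_sum]
  rw [← Fintype.prod_sum (fun (_ : Fin k) (u : ℤˣ) => Real.exp (t * ((u : ℤ) : ℝ)))]
  simp only [sum_units_exp, Finset.prod_const, Finset.card_univ, Fintype.card_fin]

theorem sum_exp_groupSum {M : ℕ} (n : Fin M → ℕ) (t : Fin M → ℝ) :
    ∑ x : SpinConfig n, Real.exp (∑ l, t l * groupSum x l) =
      ∏ l, (2 * Real.cosh (t l)) ^ n l := by
  simp only [Real.exp_sum, ← sum_exp_group]
  rw [Fintype.prod_sum (fun l (y : Fin (n l) → ℤˣ) => Real.exp (t l * ∑ i, ((y i : ℤ) : ℝ)))]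
  rfl

/-- Chernoff bound: each configuration counted contributes exactly `1` to the sum of `exp (∑ t l *
(groupSum x l - s l))`, which factorises over spins. -/
theorem card_groupSum_eq_le {M : ℕ} (n : Fin M → ℕ) (s t : Fin M → ℝ) :
    ((Finset.univ.filter fun x : SpinConfig n => groupSum x = s).card : ℝ) ≤
      ∏ l, ((2 * Real.cosh (t l)) ^ n l * Real.exp (-(t l * s l))) := by
  rw [Finset.prod_mul_distrib, ← sum_exp_groupSum, ← Real.exp_sum, Finset.sum_mul,
    Finset.card_eq_sum_ones, Nat.cast_sum, Finset.sum_filter]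
  refine Finset.sum_le_sum fun x _ => ?_
  rw [← Real.exp_add]
  split_ifs with h
  · subst h; simp
  · positivity

theorem card_image_groupSum_le {M : ℕ} (n : Fin M → ℕ) :
    (Finset.univ.image fun x : SpinConfig n => groupSum x).card ≤
      (2 * (∑ l, n l) + 1) ^ M := by
  let f : (Fin M → ℤ) → Fin M → ℝ := fun s l => (s l : ℝ)
  have hsub : (Finset.univ.image fun x : SpinConfig n => groupSum x) ⊆
      (Fintype.piFinset fun l => Finset.Icc (-(n l : ℤ)) (n l)).image f := by
    intro s hs
    obtain ⟨x, -, rfl⟩ := Finset.mem_image.1 hs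
    have hx : ∀ l, groupSum x l = ((∑ i, (x l i : ℤ) : ℤ) : ℝ) := fun l => by
      simp [groupSum, spin]
    refine Finset.mem_image.2 ⟨fun l => ∑ i, (x l i : ℤ), ?_, by ext l; rw [hx]⟩
    refine Fintype.mem_piFinset.2 fun l => ?_
    have := abs_groupSum_le x l
    rw [hx, abs_le] at this
    rw [Finset.mem_Icc]
    exact_mod_cast this
  refine (Finset.card_le_card hsub).trans (Finset.card_image_le.trans ?_)
  rw [Fintype.card_piFinset]
  refine (Finset.prod_le_pow_card _ _ (2 * (∑ l, n l) + 1) fun l _ => ?_).trans_eq (by simp)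
  rw [Int.card_Icc]
  have : n l ≤ ∑ l, n l := Finset.single_le_sum (fun _ _ => Nat.zero_le _) (Finset.mem_univ l)
  omega

open scoped Classical in
/-- A sum over configurations that depends on the magnetisations only is at most the number of
magnetisation vectors times the largest contribution. -/
theorem sum_weight_filter_le {M : ℕ} (J : Matrix (Fin M) (Fin M) ℝ) (n : Fin M → ℕ)
    (p : (Fin M → ℝ) → Prop) (B : ℝ) (hB : 0 ≤ B)
    (h : ∀ s : Fin M → ℝ, (∀ l, |s l| ≤ n l) → p s → ∃ t : Fin M → ℝ,
      Real.exp (quadForm J s / (2 * ((∑ l, n l : ℕ) : ℝ))) *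
        ∏ l, (Real.cosh (t l) ^ n l * Real.exp (-(t l * s l))) ≤ B) :
    ∑ x : SpinConfig n with p (groupSum x), weight J n x ≤
      ((2 * (∑ l, n l) + 1) ^ M : ℕ) * (2 ^ (∑ l, n l) * B) := by
  set I := Finset.univ.image fun x : SpinConfig n => groupSum x
  rw [← Finset.sum_fiberwise_of_maps_to (t := I) (g := fun x => groupSum x)
    (fun x _ => Finset.mem_image_of_mem _ (Finset.mem_univ x))]
  refine (Finset.sum_le_card_nsmul I _ (2 ^ (∑ l, n l) * B) fun s hs => ?_).trans ?_
  · by_cases hp : p s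
    · obtain ⟨x₀, -, rfl⟩ := Finset.mem_image.1 hs
      obtain ⟨t, ht⟩ := h (groupSum x₀) (abs_groupSum_le x₀) hp
      set s := groupSum x₀
      set w := Real.exp (quadForm J s / (2 * ((∑ l, n l : ℕ) : ℝ)))
      calc _ ≤ ∑ x : SpinConfig n with groupSum x = s, weight J n x := by
            refine Finset.sum_le_sum_of_subset_of_nonneg ?_ fun _ _ _ => (weight_pos _ _ _).le
            intro x hx
            simp only [Finset.mem_filter, Finset.mem_univ, true_and] at hx ⊢
            exact hx.2
        _ = ∑ x : SpinConfig n with groupSum x = s, w := by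
            refine Finset.sum_congr rfl fun x hx => ?_
            rw [weight, (Finset.mem_filter.1 hx).2]
        _ = (Finset.univ.filter fun x : SpinConfig n => groupSum x = s).card * w := by
            rw [Finset.sum_const, nsmul_eq_mul]
        _ ≤ (∏ l, ((2 * Real.cosh (t l)) ^ n l * Real.exp (-(t l * s l)))) * w :=
            mul_le_mul_of_nonneg_right (by convert card_groupSum_eq_le n s t) (Real.exp_pos _).le
        _ = 2 ^ (∑ l, n l) *
              (w * ∏ l, (Real.cosh (t l) ^ n l * Real.exp (-(t l * s l)))) := by
            simp only [mul_pow, mul_assoc, Finset.prod_mul_distrib, Finset.prod_pow_eq_pow_sum]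
            ring
        _ ≤ _ := mul_le_mul_of_nonneg_left ht (by positivity)
    · rw [Finset.sum_eq_zero]
      · positivity
      · intro x hx
        simp only [Finset.mem_filter, Finset.mem_univ, true_and] at hx
        exact absurd (hx.2 ▸ hx.1) hp
  · rw [nsmul_eq_mul]
    refine mul_le_mul_of_nonneg_right ?_ (by positivity)
    exact_mod_cast card_image_groupSum_le n

theorem two_pow_le_partitionFunction {M : ℕ} {J : Matrix (Fin M) (Fin M) ℝ} (n : Fin M → ℕ)
    (hJ : ∀ s, 0 ≤ quadForm J s) : (2 : ℝ) ^ (∑ l, n l) ≤ partitionFunction J n := by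
  have hcard : (Fintype.card (SpinConfig n) : ℝ) = 2 ^ (∑ l, n l) := by
    simp [SpinConfig, Fintype.card_pi, Finset.prod_pow_eq_pow_sum]
  rw [← hcard, partitionFunction_eq, ← Finset.card_univ, Finset.card_eq_sum_ones, Nat.cast_sum]
  refine Finset.sum_le_sum fun x _ => ?_
  rw [Nat.cast_one, weight, Real.one_le_exp_iff]
  exact div_nonneg (hJ _) (by positivity)

/-! ### Resampling one group -/

theorem groupSum_update {M : ℕ} {n : Fin M → ℕ} (x : SpinConfig n) (l : Fin M)
    (y : Fin (n l) → ℤˣ) :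
    groupSum (Function.update x l y) =
      Function.update (groupSum x) l (∑ i, ((y i : ℤ) : ℝ)) := by
  ext m
  by_cases hm : m = l
  · subst hm; simp [groupSum, spin]
  · simp [groupSum, spin, hm]

/-- The average over configurations of a function of group `l` times a function of the other
groups factorises. -/
theorem sum_mul_of_update {M : ℕ} {n : Fin M → ℕ} (l : Fin M) (F : SpinConfig n → ℝ)
    (hF : ∀ x y, F (Function.update x l y) = F x) (G : (Fin (n l) → ℤˣ) → ℝ) :
    2 ^ n l * ∑ x, F x * G (x l) = (∑ x, F x) * ∑ y, G y := by
  let e := (Equiv.piSplitAt l fun l => Fin (n l) → ℤˣ).symm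
  let f : ((m : {m // m ≠ l}) → Fin (n m) → ℤˣ) → ℝ := fun r => F (e (1, r))
  have hf : ∀ y r, F (e (y, r)) = f r := by
    intro y r
    have : e (1, r) = Function.update (e (y, r)) l 1 := by
      ext m
      by_cases hm : m = l
      · subst hm; simp [e, Equiv.piSplitAt]
      · simp [e, Equiv.piSplitAt, hm]
    simp only [f]
    rw [this, hF]
  have he : ∀ y r, e (y, r) l = y := fun y r => by simp [e, Equiv.piSplitAt]
  rw [← e.sum_comp, ← e.sum_comp, Fintype.sum_prod_type, Fintype.sum_prod_type]
  simp only [hf, he, ← Finset.sum_mul, Finset.sum_const, Finset.card_univ, nsmul_eq_mul,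
    ← Finset.mul_sum]
  simp
  ring

/-- The weight with the interactions of group `l` removed. -/
noncomputable def restWeight {M : ℕ} (J : Matrix (Fin M) (Fin M) ℝ) (n : Fin M → ℕ)
    (l : Fin M) (x : SpinConfig n) : ℝ :=
  Real.exp (quadForm J (Function.update (groupSum x) l 0) / (2 * ((∑ l, n l : ℕ) : ℝ)))

theorem restWeight_update {M : ℕ} (J : Matrix (Fin M) (Fin M) ℝ) (n : Fin M → ℕ)
    (l : Fin M) (x : SpinConfig n) (y : Fin (n l) → ℤˣ) :
    restWeight J n l (Function.update x l y) = restWeight J n l x := by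
  simp [restWeight, groupSum_update]

theorem weight_eq_restWeight_mul {M : ℕ} {J : Matrix (Fin M) (Fin M) ℝ} (hJ : J.transpose = J)
    (n : Fin M → ℕ) (l : Fin M) (x : SpinConfig n) :
    weight J n x = restWeight J n l x *
      Real.exp ((2 * groupSum x l * (∑ m, J l m * Function.update (groupSum x) l 0 m) +
        groupSum x l ^ 2 * J l l) / (2 * ((∑ l, n l : ℕ) : ℝ))) := by
  have := quadForm_update hJ (groupSum x) l (groupSum x l)
  rw [Function.update_eq_self] at this
  rw [weight, restWeight, ← Real.exp_add, this]
  congr 1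
  ring

/-- Average over the global flip of group `l`. By `exp x ≥ 1 + x`, the linear interaction terms of
`x` and its flip cancel, and the self-interaction is nonnegative. -/
theorem sum_restWeight_le {M : ℕ} {J : Matrix (Fin M) (Fin M) ℝ} (hJ : J.transpose = J)
    (n : Fin M → ℕ) (l : Fin M) (hl : 0 ≤ J l l) :
    ∑ x, restWeight J n l x ≤ partitionFunction J n := by
  let σ : SpinConfig n → SpinConfig n := fun x => Function.update x l (-(x l))
  have hσ : Function.Involutive σ := fun x => by simp [σ]
  have h1 : ∑ x, weight J n (σ x) = partitionFunction J n := by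
    rw [partitionFunction_eq]
    exact Equiv.sum_comp hσ.toPerm (weight J n)
  have h2 : ∑ x, 2 * restWeight J n l x ≤ ∑ x, (weight J n x + weight J n (σ x)) := by
    refine Finset.sum_le_sum fun x _ => ?_
    have e1 : restWeight J n l (σ x) = restWeight J n l x := restWeight_update _ _ _ _ _
    have e2 : groupSum (σ x) = Function.update (groupSum x) l (-groupSum x l) := by
      simp only [σ, groupSum_update]
      congr 1
      simp [groupSum, spin]
    rw [weight_eq_restWeight_mul hJ n l x, weight_eq_restWeight_mul hJ n l (σ x), e1, e2]
    simp only [Function.update_self, Function.update_idem]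
    set h := ∑ m, J l m * Function.update (groupSum x) l 0 m
    set N : ℝ := ((∑ l, n l : ℕ) : ℝ)
    have hN : 0 ≤ N := by positivity
    set s := groupSum x l
    have a1 := Real.add_one_le_exp ((2 * s * h + s ^ 2 * J l l) / (2 * N))
    have a2 := Real.add_one_le_exp ((2 * (-s) * h + (-s) ^ 2 * J l l) / (2 * N))
    have a3 : 0 ≤ s ^ 2 * J l l / N := by positivity
    have a4 : (2 * s * h + s ^ 2 * J l l) / (2 * N) + (2 * (-s) * h + (-s) ^ 2 * J l l) / (2 * N)
        = s ^ 2 * J l l / N := by ring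
    rw [← mul_add, mul_comm 2]
    exact mul_le_mul_of_nonneg_left (by linarith) (Real.exp_pos _).le
  rw [← Finset.mul_sum, Finset.sum_add_distrib, h1, ← partitionFunction_eq] at h2
  linarith

/-- Hoeffding's bound for group `l` under the measure without the interactions of group `l`. -/
theorem sum_restWeight_filter_le {M : ℕ} (J : Matrix (Fin M) (Fin M) ℝ)
    (n : Fin M → ℕ) (l : Fin M) {ε : ℝ} (hε : 0 ≤ ε) :
    ∑ x with ε * n l ≤ |groupSum x l|, restWeight J n l x ≤
      2 * Real.exp (-(n l * (ε ^ 2 / 2))) * ∑ x, restWeight J n l x := by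
  have key : ∀ t : ℝ, ∑ x, restWeight J n l x * Real.exp (t * groupSum x l) ≤
      Real.exp (n l * (t ^ 2 / 2)) * ∑ x, restWeight J n l x := by
    intro t
    have h := sum_mul_of_update l (restWeight J n l) (restWeight_update J n l)
      (fun y => Real.exp (t * ∑ i, ((y i : ℤ) : ℝ)))
    rw [sum_exp_group, mul_pow] at h
    have h2 : (0 : ℝ) < 2 ^ n l := by positivity
    have h3 : ∑ x, restWeight J n l x * Real.exp (t * groupSum x l) =
        Real.cosh t ^ n l * ∑ x, restWeight J n l x := by
      apply mul_left_cancel₀ h2.ne'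
      rw [← mul_assoc, ← mul_comm (∑ x, restWeight J n l x)]
      exact h
    rw [h3, Real.exp_nat_mul]
    exact mul_le_mul_of_nonneg_right (pow_le_pow_left₀ (Real.cosh_pos t).le
      (Real.cosh_le_exp_half_sq t) _) (Finset.sum_nonneg fun _ _ => (Real.exp_pos _).le)
  -- Exponential Markov inequality with tilts `ε` and `-ε`, one for each tail.
  have h1 : ∑ x with ε * n l ≤ |groupSum x l|, restWeight J n l x ≤
      ∑ x, Real.exp (-(n l * ε ^ 2)) * (restWeight J n l x * Real.exp (ε * groupSum x l) +
        restWeight J n l x * Real.exp ((-ε) * groupSum x l)) := by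
    rw [Finset.sum_filter]
    refine Finset.sum_le_sum fun x _ => ?_
    have hr : 0 < restWeight J n l x := Real.exp_pos _
    split_ifs with h
    · have h5 : 1 ≤ Real.exp (-(n l * ε ^ 2)) * (Real.exp (ε * groupSum x l) +
          Real.exp ((-ε) * groupSum x l)) := by
        rw [mul_add, ← Real.exp_add, ← Real.exp_add]
        rcases le_abs.1 h with h | h
        · have := Real.one_le_exp (x := -(n l * ε ^ 2) + ε * groupSum x l) (by nlinarith)
          linarith [Real.exp_pos (-(n l * ε ^ 2) + -ε * groupSum x l)]
        · have := Real.one_le_exp (x := -(n l * ε ^ 2) + -ε * groupSum x l) (by nlinarith)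
          linarith [Real.exp_pos (-(n l * ε ^ 2) + ε * groupSum x l)]
      rw [← mul_add, mul_left_comm]
      exact le_mul_of_one_le_right hr.le h5
    · positivity
  refine h1.trans ?_
  rw [← Finset.mul_sum, Finset.sum_add_distrib]
  have k1 := key ε
  have k2 := key (-ε)
  rw [neg_sq] at k2
  have e : Real.exp (-(n l * (ε ^ 2 / 2))) =
      Real.exp (-(n l * ε ^ 2)) * Real.exp (n l * (ε ^ 2 / 2)) := by
    rw [← Real.exp_add]; congr 1; ring
  rw [e]
  have := mul_le_mul_of_nonneg_left (add_le_add k1 k2) (Real.exp_pos (-(n l * ε ^ 2))).le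
  linarith

/-! ### Large deviation bounds for fixed group sizes -/

theorem sum_canonicalProb_filter {M : ℕ} (J : Matrix (Fin M) (Fin M) ℝ) (n : Fin M → ℕ)
    (p : SpinConfig n → Prop) [DecidablePred p] :
    ∑ x with p x, canonicalProb J n x = (∑ x with p x, weight J n x) / partitionFunction J n := by
  simp only [canonicalProb_eq, Finset.sum_div]

open scoped Classical in
/-- The deviation bound that is effective for groups of macroscopic size. -/
theorem sum_canonicalProb_le_of_subcritical {M : ℕ} {α : Fin M → ℝ}
    {J : Matrix (Fin M) (Fin M) ℝ} (h : IsSubcritical α J) (hα : ∀ l, |α l| ≤ 1)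
    {n : Fin M → ℕ} {N : ℕ} (hn : ∑ l, n l = N) {k : Fin M} (hk : 0 < n k) {ε c : ℝ}
    (hc : ∀ t : ℝ, ε ≤ |t| → |t| ≤ 1 → Real.cosh t ≤ Real.exp (t ^ 2 / 2 - c)) :
    ∑ x : SpinConfig n with ε * n k ≤ |groupSum x k|, canonicalProb J n x ≤
      (2 * N + 1) ^ M * Real.exp (N * ((1 / 2 + ∑ l, ∑ m, |J l m|) *
        ∑ l, |(n l : ℝ) / N - α l|) - c * n k) := by
  set K := ∑ l, ∑ m, |J l m|
  set D := ∑ l, |(n l : ℝ) / N - α l| with hD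
  set B := Real.exp (N * ((1 / 2 + K) * D) - c * n k)
  have hnN : ∀ l, n l ≤ N := fun l => by
    rw [← hn]; exact Finset.single_le_sum (fun _ _ => Nat.zero_le _) (Finset.mem_univ l)
  have hN : (0 : ℝ) < N := by exact_mod_cast hk.trans_le (hnN k)
  have hZ := two_pow_le_partitionFunction n h.quadForm_nonneg
  have hsum := sum_weight_filter_le J n (fun s => ε * n k ≤ |s k|) B (Real.exp_pos _).le
    fun s hs hsk => by
      -- This tilt minimises the Gaussian bound `n l * t ^ 2 / 2 - t * s l`. For an empty group, `s
      -- l = 0` and division by zero gives `t l = 0`.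
      set t : Fin M → ℝ := fun l => s l / n l with ht
      refine ⟨t, ?_⟩
      have hst : ∀ l, s l = n l * t l := by
        intro l
        rcases Nat.eq_zero_or_pos (n l) with h0 | h0
        · have := hs l
          rw [h0, Nat.cast_zero, abs_nonpos_iff] at this
          rw [this, h0]; simp
        · have : (n l : ℝ) ≠ 0 := by exact_mod_cast h0.ne'
          rw [ht]; field_simp
      have ht1 : ∀ l, |t l| ≤ 1 := fun l => by
        rw [ht]
        simp only [abs_div, Nat.abs_cast]
        exact div_le_one_of_le₀ (hs l) (Nat.cast_nonneg _)
      have htk : ε ≤ |t k| := by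
        rw [hst, abs_mul, Nat.abs_cast, mul_comm] at hsk
        exact le_of_mul_le_mul_left hsk (by exact_mod_cast hk)
      have hprod : ∏ l, (Real.cosh (t l) ^ n l * Real.exp (-(t l * s l))) ≤
          Real.exp (∑ l, (-(n l * t l ^ 2 / 2) - if l = k then c * n k else 0)) := by
        rw [Real.exp_sum]
        refine Finset.prod_le_prod (fun l _ => mul_nonneg (pow_nonneg (Real.cosh_pos _).le _)
          (Real.exp_pos _).le) fun l _ => ?_
        have hcosh : Real.cosh (t l) ≤ Real.exp (t l ^ 2 / 2 - if l = k then c else 0) := by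
          split_ifs with hlk
          · subst hlk; exact hc _ htk (ht1 _)
          · simpa using Real.cosh_le_exp_half_sq (t l)
        calc Real.cosh (t l) ^ n l * Real.exp (-(t l * s l))
            ≤ Real.exp (t l ^ 2 / 2 - if l = k then c else 0) ^ n l *
                Real.exp (-(t l * s l)) :=
              mul_le_mul_of_nonneg_right (pow_le_pow_left₀ (Real.cosh_pos _).le hcosh _)
                (Real.exp_pos _).le
          _ = _ := by
              rw [← Real.exp_nat_mul, ← Real.exp_add, hst]
              congr 1
              split_ifs with hlk
              · subst hlk; ring
              · ring
      -- Subcriticality is stated for `α`, so `n l / N` is exchanged for `α l` and back. After the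
      -- factor `N / 2`, the first exchange costs `N * K * D` (`quadForm_mul_le`) and the second `N
      -- * D / 2`.
      have hQ : quadForm J s / (2 * ((∑ l, n l : ℕ) : ℝ)) ≤
          (∑ l, n l * t l ^ 2 / 2) + N * ((1 / 2 + K) * D) := by
        have e : s = (N : ℝ) • fun l => (n l : ℝ) / N * t l := by
          ext l
          rw [Pi.smul_apply, smul_eq_mul, hst]
          field_simp
        rw [hn, e, quadForm_smul]
        have q1 := quadForm_mul_le J (a := fun l => (n l : ℝ) / N) (α := α) (m := t)
          (fun l => by
            rw [abs_div, Nat.abs_cast, Nat.abs_cast]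
            exact div_le_one_of_le₀ (by exact_mod_cast hnN l) hN.le) hα ht1
        have q2 := h.quadForm_le t
        have q3 : ∑ l, α l * t l ^ 2 ≤ (∑ l, (n l : ℝ) / N * t l ^ 2) + D := by
          rw [hD, ← Finset.sum_add_distrib]
          refine Finset.sum_le_sum fun l _ => ?_
          have r1 : t l ^ 2 ≤ 1 := by
            rw [← sq_abs]; exact pow_le_one₀ (abs_nonneg _) (ht1 l)
          have r2 := neg_abs_le ((n l : ℝ) / N - α l)
          nlinarith [sq_nonneg (t l), abs_nonneg ((n l : ℝ) / N - α l)]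
        have q4 : ∑ l, (n l : ℝ) * t l ^ 2 / 2 = N / 2 * ∑ l, (n l : ℝ) / N * t l ^ 2 := by
          rw [Finset.mul_sum]
          exact Finset.sum_congr rfl fun l _ => by field_simp
        rw [q4]
        have q5 : (N : ℝ) ^ 2 * quadForm J (fun l => (n l : ℝ) / N * t l) / (2 * N) =
            N / 2 * quadForm J (fun l => (n l : ℝ) / N * t l) := by field_simp
        rw [q5]
        have q6 := mul_le_mul_of_nonneg_left (q1.trans (add_le_add_left (q2.trans q3) _))
          (show (0 : ℝ) ≤ N / 2 by positivity)
        refine q6.trans_eq ?_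
        ring
      refine (mul_le_mul (Real.exp_le_exp.2 hQ) hprod (Finset.prod_nonneg fun l _ =>
        mul_nonneg (pow_nonneg (Real.cosh_pos _).le _) (Real.exp_pos _).le)
        (Real.exp_pos _).le).trans_eq ?_
      rw [← Real.exp_add, Finset.sum_sub_distrib, Finset.sum_neg_distrib, Finset.sum_ite_eq']
      simp only [Finset.mem_univ, if_true]
      congr 1
      ring
  rw [sum_canonicalProb_filter, div_le_iff₀ (partitionFunction_pos J n)]
  refine le_trans ?_ (mul_le_mul_of_nonneg_left hZ (by positivity))
  refine (le_trans (le_of_eq ?_) hsum).trans_eq ?_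
  · congr
  · rw [hn]; push_cast; ring

open scoped Classical in
/-- The deviation bound that is effective for groups of negligible size, on the event that all
other groups have small magnetisation. -/
theorem sum_canonicalProb_le_of_small {M : ℕ} {J : Matrix (Fin M) (Fin M) ℝ}
    (hJ : J.transpose = J) {n : Fin M → ℕ} {N : ℕ} (hn : ∑ l, n l = N) (hN : 0 < N)
    {l : Fin M} (hl : 0 ≤ J l l) {ε δ : ℝ} (hε : 0 ≤ ε)
    (hδ : 2 * (∑ m, |J l m|) * δ ≤ ε ^ 2 / 4) (hnl : n l ≤ δ * N) :
    ∑ x : SpinConfig n with ε * n l ≤ |groupSum x l| ∧ ∀ m, m ≠ l → |groupSum x m| ≤ δ * N,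
      canonicalProb J n x ≤ 2 * Real.exp (-(n l * (ε ^ 2 / 4))) := by
  set C := ∑ m, |J l m|
  have hN' : (0 : ℝ) < N := by exact_mod_cast hN
  -- Forced by `0 ≤ n l ≤ δ * N`.
  have hδ0 : 0 ≤ δ := by
    by_contra hneg
    have : δ * N < 0 := mul_neg_of_neg_of_pos (not_le.1 hneg) hN'
    linarith [(Nat.cast_nonneg (n l) : (0 : ℝ) ≤ n l)]
  have hC : J l l ≤ C := (le_abs_self _).trans
    (Finset.single_le_sum (f := fun m => |J l m|) (fun _ _ => abs_nonneg _) (Finset.mem_univ l))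
  have hC0 : 0 ≤ C := hl.trans hC
  -- On this event the exponent involving group `l` is at most `(3 / 2) * C * δ * n l`: the cross
  -- term gives `C * δ * n l`, the self-interaction half of that. By `hδ` this is at most `n l * ε ^
  -- 2 / 4`.
  have hw : ∑ x : SpinConfig n with ε * n l ≤ |groupSum x l| ∧
      ∀ m, m ≠ l → |groupSum x m| ≤ δ * N, weight J n x ≤
      ∑ x : SpinConfig n with ε * n l ≤ |groupSum x l|,
        Real.exp (n l * (ε ^ 2 / 4)) * restWeight J n l x := by
    refine le_trans (Finset.sum_le_sum (g := fun x => Real.exp (n l * (ε ^ 2 / 4)) *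
      restWeight J n l x) fun x hx => ?_) (Finset.sum_le_sum_of_subset_of_nonneg ?_
        fun _ _ _ => mul_nonneg (Real.exp_pos _).le (Real.exp_pos _).le)
    · simp only [Finset.mem_filter, Finset.mem_univ, true_and] at hx
      rw [weight_eq_restWeight_mul hJ n l x, mul_comm]
      refine mul_le_mul_of_nonneg_right (Real.exp_le_exp.2 ?_) (Real.exp_pos _).le
      set s := groupSum x l
      set g := ∑ m, J l m * Function.update (groupSum x) l 0 m
      have hs : |s| ≤ n l := abs_groupSum_le x l
      have hg : |g| ≤ C * (δ * N) := by
        refine (Finset.abs_sum_le_sum_abs _ _).trans ?_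
        rw [Finset.sum_mul]
        refine Finset.sum_le_sum fun m _ => ?_
        rw [abs_mul]
        refine mul_le_mul_of_nonneg_left ?_ (abs_nonneg _)
        by_cases hm : m = l
        · subst hm; simp; positivity
        · simpa [hm] using hx.2 m hm
      have h1 : s * g ≤ n l * (C * (δ * N)) := by
        refine (le_abs_self _).trans ?_
        rw [abs_mul]
        exact mul_le_mul hs hg (abs_nonneg _) (Nat.cast_nonneg _)
      have h2 : s ^ 2 * J l l ≤ n l * (δ * N) * C := by
        refine mul_le_mul ?_ hC hl (by positivity)
        rw [← sq_abs, sq]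
        exact mul_le_mul hs (hs.trans hnl) (abs_nonneg _) (Nat.cast_nonneg _)
      have hn0 : (0 : ℝ) ≤ n l := Nat.cast_nonneg _
      have h3 : (n l : ℝ) * (2 * C * δ) ≤ n l * (ε ^ 2 / 4) := mul_le_mul_of_nonneg_left hδ hn0
      refine le_trans ?_ h3
      rw [hn, div_le_iff₀ (by positivity)]
      have h4 : 0 ≤ n l * (C * (δ * N)) := by positivity
      linarith
    · intro x hx
      simp only [Finset.mem_filter, Finset.mem_univ, true_and] at hx ⊢
      exact hx.1
  have hH := sum_restWeight_filter_le J n l hε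
  have hZ := sum_restWeight_le hJ n l hl
  rw [sum_canonicalProb_filter, div_le_iff₀ (partitionFunction_pos J n)]
  refine hw.trans ?_
  rw [← Finset.mul_sum]
  refine (mul_le_mul_of_nonneg_left (le_trans (le_of_eq (by congr)) (hH.trans
    (mul_le_mul_of_nonneg_left hZ (by positivity)))) (Real.exp_pos _).le).trans_eq ?_
  rw [← mul_assoc, mul_left_comm, ← Real.exp_add]
  congr 3
  ring

/-! ### From the canonical ensemble to the probability space -/

-- The variables take spin values only almost surely: the disjoint events `E x` have probabilities
-- summing to `1`. Working up to null sets, an upper bound needs no measurability of `p`.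
open scoped Classical in
theorem IsCanonicalEnsemble.measure_le {M : ℕ} {J : Matrix (Fin M) (Fin M) ℝ} {n : Fin M → ℕ}
    {Ω : Type*} [MeasurableSpace Ω] {P : Measure Ω} [IsProbabilityMeasure P]
    {X : (l : Fin M) → Fin (n l) → Ω → ℝ} (hX : IsCanonicalEnsemble J n P X)
    (p : (Fin M → ℝ) → Prop) :
    P {ω | p fun l => ∑ i, X l i ω} ≤
      ENNReal.ofReal (∑ x : SpinConfig n with p (groupSum x), canonicalProb J n x) := by
  let E : SpinConfig n → Set Ω := fun x => {ω | ∀ l i, X l i ω = spin x l i}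
  have hE : ∀ x, MeasurableSet (E x) := fun x => by
    have : E x = ⋂ l, ⋂ i, X l i ⁻¹' {spin x l i} := by ext; simp [E]
    rw [this]
    exact MeasurableSet.iInter fun l => MeasurableSet.iInter fun i =>
      hX.measurable l i (measurableSet_singleton _)
  have hdisj : Pairwise (Function.onFun Disjoint E) := by
    intro x y hxy
    refine Set.disjoint_left.2 fun ω hx hy => hxy ?_
    funext l i
    have := (hx l i).symm.trans (hy l i)
    simp only [spin] at this
    exact Units.ext (by exact_mod_cast this)
  have hone : P (⋃ x, E x) = 1 := by
    rw [measure_iUnion hdisj hE, tsum_fintype]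
    simp only [E, hX.law]
    rw [← ENNReal.ofReal_sum_of_nonneg fun x _ => (canonicalProb_pos J n x).le,
      sum_canonicalProb, ENNReal.ofReal_one]
  have hae : ∀ᵐ ω ∂P, ω ∈ ⋃ x, E x := by
    rw [← prob_compl_eq_zero_iff (MeasurableSet.iUnion hE)] at hone
    exact hone
  have hle : P {ω | p fun l => ∑ i, X l i ω} ≤
      P (⋃ x ∈ Finset.univ.filter fun x : SpinConfig n => p (groupSum x), E x) := by
    refine measure_mono_ae ?_
    filter_upwards [hae] with ω hω hp
    obtain ⟨x, hx⟩ := Set.mem_iUnion.1 hω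
    have e : (fun l => ∑ i, X l i ω) = groupSum x := by
      funext l
      exact Finset.sum_congr rfl fun i _ => hx l i
    exact Set.mem_biUnion (x := x)
      (Finset.mem_coe.2 (Finset.mem_filter.2 ⟨Finset.mem_univ _, e ▸ hp⟩)) hx
  refine hle.trans ((measure_biUnion_finset_le _ _).trans_eq ?_)
  rw [ENNReal.ofReal_sum_of_nonneg fun x _ => (canonicalProb_pos J n x).le]
  exact Finset.sum_congr rfl fun x _ => hX.law x

/-- The first Borel–Cantelli lemma for probabilities that are eventually at most `1 / N ^ 2`. -/
theorem ae_eventually_not_of_le_inv_sq {Ω : Type*} [MeasurableSpace Ω] {P : Measure Ω}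
    [IsProbabilityMeasure P] {E : ℕ → Set Ω} {b : ℕ → ℝ}
    (hE : ∀ᶠ N in atTop, P (E N) ≤ ENNReal.ofReal (b N))
    (hb : ∀ᶠ N : ℕ in atTop, b N ≤ 1 / (N : ℝ) ^ 2) :
    ∀ᵐ ω ∂P, ∀ᶠ N in atTop, ω ∉ E N := by
  have hs : Summable fun N => P.real (E N) := by
    refine summable_of_isBigO_nat (Real.summable_one_div_nat_pow.2 one_lt_two) ?_
    refine Asymptotics.IsBigO.of_bound 1 ?_
    filter_upwards [hE, hb] with N h1 h2
    have h3 : P.real (E N) ≤ 1 / (N : ℝ) ^ 2 :=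
      ENNReal.toReal_le_of_le_ofReal (by positivity) (h1.trans (ENNReal.ofReal_le_ofReal h2))
    rw [Real.norm_of_nonneg measureReal_nonneg, Real.norm_of_nonneg (by positivity), one_mul]
    exact h3
  refine ae_eventually_notMem ?_
  have := hs.tsum_ofReal_ne_top
  simpa [Measure.real] using this

/-! ### Almost sure convergence -/

/-- Use `2 * N + 1 ≤ 3 * N` and `x ^ (M + 2) * exp (-x) → 0` at `x = b * N`. -/
theorem eventually_poly_mul_exp_le (M : ℕ) {b : ℝ} (hb : 0 < b) :
    ∀ᶠ N : ℕ in atTop,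
      (2 * (N : ℝ) + 1) ^ M * Real.exp (-(b * N)) ≤ 1 / (N : ℝ) ^ 2 := by
  have h1 : Tendsto (fun N : ℕ => b * (N : ℝ)) atTop atTop :=
    tendsto_natCast_atTop_atTop.const_mul_atTop hb
  have h2 := (Real.tendsto_pow_mul_exp_neg_atTop_nhds_zero (M + 2)).comp h1
  have h3 : (0 : ℝ) < b ^ (M + 2) / 3 ^ M := by positivity
  filter_upwards [h2.eventually_le_const h3, eventually_ge_atTop 1] with N hN hN1
  have hN1' : (1 : ℝ) ≤ N := by exact_mod_cast hN1
  rw [le_div_iff₀ (by positivity)]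
  have h4 : (2 * (N : ℝ) + 1) ^ M ≤ 3 ^ M * (N : ℝ) ^ M := by
    rw [← mul_pow]
    exact pow_le_pow_left₀ (by positivity) (by linarith) _
  have h5 : b ^ (M + 2) * ((N : ℝ) ^ (M + 2) * Real.exp (-(b * N))) ≤
      b ^ (M + 2) * (1 / 3 ^ M) := by
    refine le_trans (le_of_eq ?_) (hN.trans_eq ?_)
    · simp only [Function.comp_apply, mul_pow]; ring
    · ring
  have h6 := le_of_mul_le_mul_left h5 (by positivity)
  rw [le_div_iff₀ (by positivity)] at h6
  calc (2 * (N : ℝ) + 1) ^ M * Real.exp (-(b * N)) * (N : ℝ) ^ 2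
      ≤ 3 ^ M * (N : ℝ) ^ M * Real.exp (-(b * N)) * (N : ℝ) ^ 2 := by gcongr
    _ = (N : ℝ) ^ (M + 2) * Real.exp (-(b * N)) * 3 ^ M := by ring
    _ ≤ 1 := h6

theorem eventually_exp_neg_le_inv_sq {k : ℕ → ℕ} {c : ℝ} (hc : 0 < c)
    (hk : Tendsto k atTop atTop)
    (hlog : Tendsto (fun N : ℕ => Real.log (N : ℝ) / (k N : ℝ)) atTop (𝓝 0)) :
    ∀ᶠ N : ℕ in atTop, 2 * Real.exp (-(k N * c)) ≤ 1 / (N : ℝ) ^ 2 := by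
  -- Eventually `k N * c ≥ 3 * log N`, so the exponential is at most `N ^ (-3)`; the spare factor `N
  -- ≥ 2` absorbs the `2`.
  have h3 : (0 : ℝ) < c / 3 := by positivity
  filter_upwards [hlog.eventually_le_const h3, hk.eventually_ge_atTop 1,
    eventually_ge_atTop 2] with N hN hk1 hN2
  have hN2' : (2 : ℝ) ≤ N := by exact_mod_cast hN2
  have hk1' : (0 : ℝ) < k N := by exact_mod_cast hk1
  rw [div_le_iff₀ hk1'] at hN
  have h1 : Real.exp (-(k N * c)) ≤ Real.exp (-(3 * Real.log N)) :=
    Real.exp_le_exp.2 (by linarith)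
  have h2 : Real.exp (-(3 * Real.log N)) = 1 / (N : ℝ) ^ 3 := by
    rw [Real.exp_neg, mul_comm, Real.exp_mul, Real.exp_log (by positivity), one_div]
    norm_cast
  rw [h2] at h1
  refine (mul_le_mul_of_nonneg_left h1 zero_le_two).trans ?_
  rw [mul_one_div, div_le_div_iff₀ (by positivity) (by positivity)]
  nlinarith [sq_nonneg (N : ℝ)]

section

variable {M : ℕ} {J : Matrix (Fin M) (Fin M) ℝ} {α : Fin M → ℝ} {n : ℕ → Fin M → ℕ}

theorem limit_ratio_nonneg
    (hlim : ∀ l, Tendsto (fun N : ℕ => (n N l : ℝ) / (N : ℝ)) atTop (𝓝 (α l))) (l : Fin M) :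
    0 ≤ α l :=
  ge_of_tendsto' (hlim l) fun N => by positivity

theorem sum_limit_ratio (hsum : ∀ N, ∑ l, n N l = N)
    (hlim : ∀ l, Tendsto (fun N : ℕ => (n N l : ℝ) / (N : ℝ)) atTop (𝓝 (α l))) :
    ∑ l, α l = 1 := by
  refine tendsto_nhds_unique (tendsto_finsetSum _ fun l _ => hlim l) ?_
  refine tendsto_const_nhds.congr' ?_
  filter_upwards [eventually_ge_atTop 1] with N hN
  rw [← Finset.sum_div, ← Nat.cast_sum, hsum, div_self (by positivity)]

variable {Ω : Type*} [MeasurableSpace Ω] {P : Measure Ω} [IsProbabilityMeasure P]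
  {X : (N : ℕ) → (l : Fin M) → Fin (n N l) → Ω → ℝ}

theorem ae_eventually_lt_of_pos (h : IsSubcritical α J) (hsum : ∀ N, ∑ l, n N l = N)
    (hlim : ∀ l, Tendsto (fun N : ℕ => (n N l : ℝ) / (N : ℝ)) atTop (𝓝 (α l)))
    (hX : ∀ N, IsCanonicalEnsemble J (n N) P (X N)) {k : Fin M} (hk : 0 < α k)
    {ε : ℝ} (hε : 0 < ε) :
    ∀ᵐ ω ∂P, ∀ᶠ N in atTop, |∑ i, X N k i ω| < ε * n N k := by
  classical
  obtain ⟨c, hc0, hc⟩ := exists_cosh_le hε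
  have hα : ∀ l, |α l| ≤ 1 := fun l => by
    rw [abs_of_nonneg (limit_ratio_nonneg hlim l), ← sum_limit_ratio hsum hlim]
    exact Finset.single_le_sum (fun l _ => limit_ratio_nonneg hlim l) (Finset.mem_univ l)
  set K := 1 / 2 + ∑ l, ∑ m, |J l m|
  have hD : Tendsto (fun N : ℕ => K * ∑ l, |(n N l : ℝ) / N - α l|) atTop (𝓝 0) := by
    have : Tendsto (fun N : ℕ => K * ∑ l, |(n N l : ℝ) / N - α l|) atTop
        (𝓝 (K * ∑ l, |α l - α l|)) :=
      (tendsto_finsetSum _ fun l _ => ((hlim l).sub_const (α l)).abs).const_mul K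
    simpa using this
  -- Eventually `n k ≥ α k * N / 2`, so the gain `c * n k` is at least `c * α k / 2 * N`; the error
  -- may use up half of it.
  have h4 : 0 < c * α k / 4 := by positivity
  have hev : ∀ᶠ N : ℕ in atTop, 0 < n N k ∧
      N * (K * ∑ l, |(n N l : ℝ) / N - α l|) - c * n N k ≤ -(c * α k / 4 * N) := by
    filter_upwards [hD.eventually_le_const h4,
      (hlim k).eventually_const_le (half_lt_self hk), eventually_ge_atTop 1] with N h1 h2 h3
    have hN : (0 : ℝ) < N := by exact_mod_cast h3
    rw [le_div_iff₀ hN] at h2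
    refine ⟨?_, ?_⟩
    · have : (0 : ℝ) < n N k := lt_of_lt_of_le (by positivity) h2
      exact_mod_cast this
    · have a1 := mul_le_mul_of_nonneg_left h1 hN.le
      have a2 := mul_le_mul_of_nonneg_left h2 hc0.le
      linarith
  have hP : ∀ᶠ N : ℕ in atTop, P {ω | ε * n N k ≤ |∑ i, X N k i ω|} ≤
      ENNReal.ofReal ((2 * (N : ℝ) + 1) ^ M * Real.exp (-(c * α k / 4 * N))) := by
    filter_upwards [hev] with N hN
    refine ((hX N).measure_le fun s => ε * n N k ≤ |s k|).trans (ENNReal.ofReal_le_ofReal ?_)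
    refine (sum_canonicalProb_le_of_subcritical h hα (hsum N) hN.1 hc).trans ?_
    exact mul_le_mul_of_nonneg_left (Real.exp_le_exp.2 hN.2) (by positivity)
  filter_upwards [ae_eventually_not_of_le_inv_sq hP (eventually_poly_mul_exp_le M h4)] with ω hω
  filter_upwards [hω] with N hN
  exact not_le.1 hN

theorem ae_eventually_lt_of_zero (h : IsSubcritical α J) (hsum : ∀ N, ∑ l, n N l = N)
    (hlim : ∀ l, Tendsto (fun N : ℕ => (n N l : ℝ) / (N : ℝ)) atTop (𝓝 (α l)))
    (hinf : ∀ l, Tendsto (fun N : ℕ => n N l) atTop atTop)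
    (hX : ∀ N, IsCanonicalEnsemble J (n N) P (X N)) {l : Fin M} (hl : α l = 0)
    (hlog : Tendsto (fun N : ℕ => Real.log (N : ℝ) / (n N l : ℝ)) atTop (𝓝 0))
    {ε : ℝ} (hε : 0 < ε) :
    ∀ᵐ ω ∂P, ∀ᶠ N in atTop, |∑ i, X N l i ω| < ε * n N l := by
  classical
  set C := ∑ m, |J l m|
  have hC : 0 ≤ C := Finset.sum_nonneg fun _ _ => abs_nonneg _
  -- `C + 1` rather than `C` keeps the denominator positive when row `l` of `J` vanishes.
  set δ := ε ^ 2 / (8 * (C + 1))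
  have hδ : 0 < δ := by positivity
  have hCδ : 2 * C * δ ≤ ε ^ 2 / 4 := by
    have : (C + 1) * δ = ε ^ 2 / 8 := by simp only [δ]; field_simp
    linarith
  have hsmall : ∀ m, α m = 0 → ∀ᶠ N : ℕ in atTop, (n N m : ℝ) ≤ δ * N := by
    intro m hm
    filter_upwards [(hm ▸ hlim m).eventually_le_const hδ, eventually_ge_atTop 1] with N h1 h2
    rwa [div_le_iff₀ (by exact_mod_cast h2)] at h1
  have hP : ∀ᶠ N : ℕ in atTop, P {ω | ε * n N l ≤ |∑ i, X N l i ω| ∧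
      ∀ m, m ≠ l → |∑ i, X N m i ω| ≤ δ * N} ≤
      ENNReal.ofReal (2 * Real.exp (-(n N l * (ε ^ 2 / 4)))) := by
    filter_upwards [hsmall l hl, eventually_ge_atTop 1] with N h1 h2
    refine ((hX N).measure_le fun s => ε * n N l ≤ |s l| ∧
      ∀ m, m ≠ l → |s m| ≤ δ * N).trans (ENNReal.ofReal_le_ofReal ?_)
    convert sum_canonicalProb_le_of_small h.transpose_eq (hsum N) h2 (h.diag_nonneg l) hε.le hCδ h1
  have hbc := ae_eventually_not_of_le_inv_sq hP
    (eventually_exp_neg_le_inv_sq (by positivity) (hinf l) hlog)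
  -- No circularity between negligible groups: their size alone gives this bound, and the
  -- macroscopic groups are already settled.
  have hrest : ∀ᵐ ω ∂P, ∀ m, ∀ᶠ N : ℕ in atTop, |∑ i, X N m i ω| ≤ δ * N := by
    refine ae_all_iff.2 fun m => ?_
    rcases (limit_ratio_nonneg hlim m).eq_or_lt with hm | hm
    · -- a group of negligible size has at most `δ * N` members
      have hspin : ∀ᵐ ω ∂P, ∀ N, |∑ i, X N m i ω| ≤ n N m := by
        refine ae_all_iff.2 fun N => ?_
        rw [ae_iff]
        have := (hX N).measure_le fun s => ¬ |s m| ≤ n N m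
        simpa [abs_groupSum_le, not_lt] using this
      filter_upwards [hspin] with ω hω
      filter_upwards [hsmall m hm.symm] with N hN
      exact (hω N).trans hN
    · filter_upwards [ae_eventually_lt_of_pos h hsum hlim hX hm hδ] with ω hω
      filter_upwards [hω] with N hN
      refine hN.le.trans (mul_le_mul_of_nonneg_left ?_ hδ.le)
      have hle : n N m ≤ ∑ l, n N l :=
        Finset.single_le_sum (fun _ _ => Nat.zero_le _) (Finset.mem_univ m)
      rw [hsum N] at hle
      exact_mod_cast hle
  filter_upwards [hbc, hrest] with ω h1 h2
  filter_upwards [h1, eventually_all.2 h2] with N h3 h4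
  by_contra h5
  exact h3 ⟨not_lt.1 h5, fun m _ => h4 m⟩

end

end CurieWeiss

theorem mainTheorem10 {M : ℕ} (J : Matrix (Fin M) (Fin M) ℝ) (α : Fin M → ℝ)
    (n : ℕ → Fin M → ℕ)
    (hsum : ∀ N, ∑ l, n N l = N)
    (hlim : ∀ l, Tendsto (fun N : ℕ => (n N l : ℝ) / (N : ℝ)) atTop (𝓝 (α l)))
    (hinf : ∀ l, Tendsto (fun N : ℕ => n N l) atTop atTop)
    (hsmall : ∀ l, α l = 0 →
      Tendsto (fun N : ℕ => Real.log (N : ℝ) / (n N l : ℝ)) atTop (𝓝 0))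
    (hregime : CurieWeiss.IsHighTemperature α J ∨ CurieWeiss.IsCritical α J)
    {Ω : Type*} [MeasurableSpace Ω] (P : Measure Ω) [IsProbabilityMeasure P]
    (X : (N : ℕ) → (l : Fin M) → Fin (n N l) → Ω → ℝ)
    (hX : ∀ N, CurieWeiss.IsCanonicalEnsemble J (n N) P (X N)) :
    ∀ᵐ ω ∂P, Tendsto (fun N : ℕ => CurieWeiss.normalisedMagnetisation (X N) ω) atTop (𝓝 0) := by
  have hα := CurieWeiss.limit_ratio_nonneg hlim
  have h := CurieWeiss.isSubcritical_of_regime hα (CurieWeiss.sum_limit_ratio hsum hlim) hregime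
  -- Only countably many thresholds `1 / (j + 1)`, so that a single null set serves all of them.
  have key : ∀ᵐ ω ∂P, ∀ l, ∀ j : ℕ, ∀ᶠ N in atTop,
      |∑ i, X N l i ω| < 1 / ((j : ℝ) + 1) * n N l := by
    refine ae_all_iff.2 fun l => ae_all_iff.2 fun j => ?_
    rcases (hα l).eq_or_lt with hl | hl
    · exact CurieWeiss.ae_eventually_lt_of_zero h hsum hlim hinf hX hl.symm (hsmall l hl.symm)
        Nat.one_div_pos_of_nat
    · exact CurieWeiss.ae_eventually_lt_of_pos h hsum hlim hX hl Nat.one_div_pos_of_nat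
  filter_upwards [key] with ω hω
  refine tendsto_pi_nhds.2 fun l => Metric.tendsto_atTop'.2 fun ε hε => ?_
  obtain ⟨j, hj⟩ := exists_nat_one_div_lt hε
  obtain ⟨N₀, hN₀⟩ := eventually_atTop.1 ((hω l j).and ((hinf l).eventually_ge_atTop 1))
  refine ⟨N₀, fun N hN => ?_⟩
  obtain ⟨h1, h2⟩ := hN₀ N hN.le
  have hpos : (0 : ℝ) < n N l := by exact_mod_cast h2
  rw [Real.dist_eq, Pi.zero_apply, sub_zero, CurieWeiss.normalisedMagnetisation, abs_div,
    Nat.abs_cast]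
  exact ((div_lt_iff₀ hpos).2 h1).trans hj
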